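/- **Definitions.** Two distinct points of $\mathbb{Z}^2$ are $c_1$-adjacent if they differ in exactly one coordinate, and there by $1$; they are $c_2$-adjacent if each coordinate differs by at most $1$. For $\kappa\in\{c_1,c_2\}$, a set is $\kappa$-connected if any two of its points are joined by a $\kappa$-path inside it. A map $f:X\to X$ is $\kappa$-continuous if it maps $\kappa$-connected sets to $\kappa$-connected sets. A set $A\subseteq X$ is a freezing set for $(X,\kappa)$ if every $\kappa$-continuous $f:X\to X$ with $f(a)=a$ for all $a\in A$ is the identity; it is minimal if no proper subset of $A$ is a freezing set for $(X,\kappa)$. $Bd(X)$ is the set of points of $X$ that have a $c_1$-neighbor in $\mathbb{Z}^2\setminus X$. A $c_2$-closed curve $S$ is a cyclic sequence $s_0,\dots,s_{n-1}$ of distinct points of $\mathbb{Z}^2$, cyclically consecutive ones being $c_2$-adjacent. Its sides (edges) are the maximal straight runs of at least two consecutive points of the sequence; a side is horizontal, vertical or slanted (of slope $\pm1$). $S$ is a bounding curve of $X\subset\mathbb{Z}^2$, and $X$ is a digital disk, if $\mathbb{Z}^2\setminus S$ has exactly two $c_1$-components, one finite and one infinite, and $X$ is the union of $S$ and the finite one.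 A disk $X$ is a convex disk with bounding curve $S$ if, moreover, the sides of $S$ lie along the boundary of the polygon $\mathrm{hull}(X)\subset\mathbb{R}^2$ (the convex hull of $X$) and the endpoints of the sides of $S$ are exactly the vertices of $\mathrm{hull}(X)$. A disk $X$ is thick if for some bounding curve $S'$ of $X$: - whenever $p$ is a non-endpoint of a slanted segment contained in $Bd(X)$, there is a $c\in X$, not on the line of that segment, which is $c_2$-adjacent but not $c_1$-adjacent to $p$; - whenever $p$ is the vertex of an interior angle $\theta$ of $S'$ of $135^\circ$, there are $b,b'\in X$ in the interior of $\theta$ such that $b$ is $c_2$-adjacent but not $c_1$-adjacent to $p$, and $b'$ is $c_1$-adjacent to $p$. (The interior angle of a closed curve at a vertex is the one on its left if the curve encloses positive signed area, and the one on its right if it encloses negative signed area.) **Theorem.** Let $X\subset\mathbb{Z}^2$ be a thick convex disk with bounding curve $S$. Let $A_1$ be the set of endpoints of the horizontal and vertical sides of $S$, and let $A_2$ be the union of the slanted sides of $S$. Then $A=A_1\cup A_2$ is a minimal freezing set for $(X,c_1)$. -/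

import Mathlib

namespace DigitalPlane

/-- Points of the digital plane. -/
abbrev Pt : Type := ℤ × ℤ

/-- `c₁`-adjacency: exactly one coordinate differs, and it differs by one. -/
def c1 : SimpleGraph Pt where
  Adj p q := |p.1 - q.1| + |p.2 - q.2| = 1
  symm := ⟨fun p q h => by rw [abs_sub_comm q.1, abs_sub_comm q.2]; exact h⟩
  loopless := ⟨fun p h => by simp at h⟩

/-- `c₂`-adjacency: the points are distinct and each coordinate differs by at most one. -/
def c2 : SimpleGraph Pt where
  Adj p q := p ≠ q ∧ |p.1 - q.1| ≤ 1 ∧ |p.2 - q.2| ≤ 1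
  symm := ⟨fun p q h => by
    rw [abs_sub_comm q.1, abs_sub_comm q.2]; exact ⟨h.1.symm, h.2⟩⟩
  loopless := ⟨fun p h => h.1 rfl⟩

/-- A set of points is `κ`-connected if any two of its points are joined by a `κ`-path in it. -/
def DConnected (κ : SimpleGraph Pt) (A : Set Pt) : Prop :=
  (κ.induce A).Preconnected

/-- `C` is a `κ`-component of `Y`. -/
def IsComponent (κ : SimpleGraph Pt) (Y C : Set Pt) : Prop :=
  C.Nonempty ∧ Maximal (fun B => B ⊆ Y ∧ DConnected κ B) C

/-- Digital continuity of a self-map: images of `κ`-connected sets are `κ`-connected. -/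
def DContinuous (κ : SimpleGraph Pt) (X : Set Pt) (f : X → X) : Prop :=
  ∀ A : Set X, DConnected κ (Subtype.val '' A) → DConnected κ (Subtype.val '' (f '' A))

/-- `A` is a freezing set for `(X, κ)`. -/
def IsFreezingSet (κ : SimpleGraph Pt) (X A : Set Pt) : Prop :=
  A ⊆ X ∧ ∀ f : X → X, DContinuous κ X f → (∀ x : X, (x : Pt) ∈ A → f x = x) → f = id

/-- A freezing set none of whose proper subsets is a freezing set. -/
def IsMinimalFreezingSet (κ : SimpleGraph Pt) (X A : Set Pt) : Prop :=
  IsFreezingSet κ X A ∧ ∀ B : Set Pt, B ⊂ A → ¬ IsFreezingSet κ X B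

/-- The boundary `Bd(X)`: the points of `X` with a `c₁`-neighbor outside `X`. -/
def bd (X : Set Pt) : Set Pt := {x ∈ X | ∃ y, y ∉ X ∧ c1.Adj y x}

/-- A `c₂`-closed curve: a closed `c₂`-path which visits no point twice except that it returns to
its start. The path is unrolled to a sequence indexed by `ℤ` with period `len`, the number of its
points. -/
structure ClosedCurve where
  len : ℕ
  len_pos : 0 < len
  pt : ℤ → Pt
  periodic : ∀ i, pt (i + len) = pt i
  inj : ∀ i j, pt i = pt j → i ≡ j [ZMOD len]
  adj : ∀ i, c2.Adj (pt i) (pt (i + 1))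

namespace ClosedCurve

/-- The set of points of the curve. -/
def carrier (S : ClosedCurve) : Set Pt := Set.range S.pt

/-- The step of the curve from its `i`-th point to the next. -/
def step (S : ClosedCurve) (i : ℤ) : Pt := S.pt (i + 1) - S.pt i

/-- `S.pt a, S.pt (a + 1), …, S.pt b` is a side of `S`, i.e. a maximal line segment run through by
the curve. It has at least two points; its endpoints are `S.pt a` and `S.pt b`. -/
def IsSide (S : ClosedCurve) (a b : ℤ) : Prop :=
  a < b ∧ (∀ i, a ≤ i → i < b → S.step i = S.step a) ∧
    S.step (a - 1) ≠ S.step a ∧ S.step b ≠ S.step a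

end ClosedCurve

/-- A horizontal or vertical direction. -/
def IsAxial (d : Pt) : Prop := d.1 = 0 ∨ d.2 = 0

/-- A direction of slope `1` or `-1`. -/
def IsSlanted (d : Pt) : Prop := |d.1| = 1 ∧ |d.2| = 1

/-- `S` is a bounding curve of `X`: the complement of `S` has exactly two `c₁`-components, one
finite and one infinite, and `X` is the union of `S` and the finite one. A digital disk is a set
that has a bounding curve. -/
def IsBoundingCurve (S : ClosedCurve) (X : Set Pt) : Prop :=
  ∃ F I : Set Pt, F.Finite ∧ I.Infinite ∧
    {C | IsComponent c1 S.carrierᶜ C} = {F, I} ∧ X = S.carrier ∪ F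

/-- The inclusion of the digital plane in the Euclidean plane. -/
def toReal (p : Pt) : ℝ × ℝ := ((p.1 : ℝ), (p.2 : ℝ))

/-- The convex hull in the Euclidean plane of a set of lattice points. -/
def hull (X : Set Pt) : Set (ℝ × ℝ) := convexHull ℝ (toReal '' X)

/-- `X` is a digitally convex disk, with the bounding curve `S`: the sides of `S` lie along the
boundary of the polygon `hull X`, and their endpoints are precisely the vertices of that polygon. -/
def IsConvexDisk (X : Set Pt) (S : ClosedCurve) : Prop :=
  IsBoundingCurve S X ∧
    (∀ a b, S.IsSide a b →
      segment ℝ (toReal (S.pt a)) (toReal (S.pt b)) ⊆ frontier (hull X)) ∧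
    toReal '' {x | ∃ a b, S.IsSide a b ∧ (x = S.pt a ∨ x = S.pt b)} =
      Set.extremePoints ℝ (hull X)

/-- Dot product. -/
def dot (u v : Pt) : ℤ := u.1 * v.1 + u.2 * v.2

/-- Cross product. -/
def cross (u v : Pt) : ℤ := u.1 * v.2 - u.2 * v.1

/-- The directions `u` and `v` make an angle of 135 degrees: its cosine is `-1/√2`. -/
def Angle135 (u v : Pt) : Prop := dot u v < 0 ∧ 2 * dot u v ^ 2 = dot u u * dot v v

/-- For linearly independent `u`, `v`: the direction `w` points into the interior of the angle (of
less than 180 degrees) between `u` and `v`, i.e. `w` is a positive combination of `u` and `v`. -/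
def InAngle (u v w : Pt) : Prop :=
  0 < cross u w * cross u v ∧ 0 < cross w v * cross u v

namespace ClosedCurve

/-- Twice the signed area enclosed by the curve; it is positive if the curve runs
counterclockwise, negative if it runs clockwise. -/
def area2 (S : ClosedCurve) : ℤ :=
  ∑ i ∈ Finset.range S.len, cross (S.pt i) (S.pt (i + 1))

/-- The interior angle of `S` at the vertex `S.pt i` is 135 degrees: the two sides meeting there
make an angle of 135 degrees, and the curve turns there towards its interior (to the left if it
runs counterclockwise, to the right if it runs clockwise). -/
def InteriorAngle135 (S : ClosedCurve) (i : ℤ) : Prop :=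
  Angle135 (S.pt (i - 1) - S.pt i) (S.pt (i + 1) - S.pt i) ∧
    0 < cross (S.step (i - 1)) (S.step i) * S.area2

end ClosedCurve

/-- Thickness of a digital disk, for some bounding curve `S`.

* If `p` is a non-endpoint of a slanted segment of `Bd(X)`, of direction `d`, then some point `c`
  of `X` off the line of this segment is `c₂`- but not `c₁`-adjacent to `p`.
* If `p` is the vertex of an interior angle of `S` of 135 degrees, then the interior of that angle
  contains a point `b` of `X` which is `c₂`- but not `c₁`-adjacent to `p`, and a point `b'` of `X`
  which is `c₁`-adjacent to `p`. -/
def IsThick (X : Set Pt) : Prop :=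
  ∃ S : ClosedCurve, IsBoundingCurve S X ∧
    (∀ p d : Pt, IsSlanted d → p - d ∈ bd X → p ∈ bd X → p + d ∈ bd X →
      ∃ c ∈ X, c2.Adj c p ∧ ¬ c1.Adj c p ∧ cross (c - p) d ≠ 0) ∧
    (∀ i, S.InteriorAngle135 i →
      ∃ b ∈ X, ∃ b' ∈ X,
        InAngle (S.pt (i - 1) - S.pt i) (S.pt (i + 1) - S.pt i) (b - S.pt i) ∧
        InAngle (S.pt (i - 1) - S.pt i) (S.pt (i + 1) - S.pt i) (b' - S.pt i) ∧
        c2.Adj b (S.pt i) ∧ ¬ c1.Adj b (S.pt i) ∧ c1.Adj b' (S.pt i))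

/-- The endpoints of the maximal horizontal and of the maximal vertical edges of `S`. -/
def axialEndpoints (S : ClosedCurve) : Set Pt :=
  {x | ∃ a b, S.IsSide a b ∧ IsAxial (S.step a) ∧ (x = S.pt a ∨ x = S.pt b)}

/-- The union of the slanted segments of `S`. -/
def slantedPoints (S : ClosedCurve) : Set Pt :=
  {x | ∃ a b, S.IsSide a b ∧ IsSlanted (S.step a) ∧ ∃ i, a ≤ i ∧ i ≤ b ∧ x = S.pt i}

end DigitalPlane

/-! A `c1`-continuous self-map sends adjacent points to equal or adjacent ones, so it does not
lengthen paths. An axial segment of the disk is a shortest path even for the ℓ¹ metric of the plane;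
hence fixing its two ends fixes all of it (`fixes_segment`). Fixing the set therefore fixes every
axial side of the curve, and the slanted sides belong to the set. Each interior point lies on a
horizontal segment of the disk between two curve points, so it is fixed too.

For minimality it is enough to move a single omitted point `p` to some `p'` whose closed
neighborhood contains all neighbors of `p` in the disk (`not_isFreezingSet_of_move`). Convexity
gives supporting lines along the sides, all on the same hand, and identifies the disk with the
lattice points of the polygon they cut out (`eq_polygon`). At a vertex or a point of a slanted side,
no axial line through `p` continues in the disk on both sides (`sub_notMem_of_add_mem`), so `p` has
at most two neighbors, and two of them are perpendicular. In that case `p'` is the fourth corner of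
their unit square. It belongs to the disk (`add_add_mem`): a supporting line cutting it off would
confine the disk to a slanted strip too thin for an interior point together with its four neighbors.
-/

namespace DigitalPlane

/-! ### Paths, components, continuity -/

lemma dConnected_iff {κ : SimpleGraph Pt} {A : Set Pt} :
    DConnected κ A ↔ ∀ x ∈ A, ∀ y ∈ A,
      Relation.ReflTransGen (fun a b => κ.Adj a b ∧ b ∈ A) x y := by
  constructor
  · intro h x hx y hy
    have h1 := (SimpleGraph.reachable_iff_reflTransGen _ _).1 (h ⟨x, hx⟩ ⟨y, hy⟩)
    exact h1.lift (p := fun a b => κ.Adj a b ∧ b ∈ A) Subtype.val fun a b hab => ⟨hab, b.2⟩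
  · rintro h ⟨x, hx⟩ ⟨y, hy⟩
    have h1 := h x hx y hy
    clear h
    rw [SimpleGraph.reachable_iff_reflTransGen]
    induction h1 with
    | refl => exact Relation.ReflTransGen.refl
    | @tail b c hb hc ih =>
      have hbA : b ∈ A := by
        rcases Relation.ReflTransGen.cases_tail hb with h | ⟨_, _, h⟩
        · exact h ▸ hx
        · exact h.2
      exact (ih hbA).tail (by simpa using hc.1)

lemma DConnected.insert {κ : SimpleGraph Pt} {A : Set Pt} (hA : DConnected κ A) {x y : Pt}
    (hx : x ∈ A) (hxy : κ.Adj x y) : DConnected κ (Insert.insert y A) := by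
  rw [dConnected_iff] at hA ⊢
  have hm : ∀ a ∈ A, ∀ b ∈ A,
      Relation.ReflTransGen (fun a b => κ.Adj a b ∧ b ∈ Insert.insert y A) a b := fun a ha b hb =>
    (hA a ha b hb).lift id fun _ _ h => ⟨h.1, Or.inr h.2⟩
  rintro a (rfl | ha) b (rfl | hb)
  · exact Relation.ReflTransGen.refl
  · exact Relation.ReflTransGen.head ⟨hxy.symm, Or.inr hx⟩ (hm x hx b hb)
  · exact (hm a ha x hx).tail ⟨hxy, Or.inl rfl⟩
  · exact hm a ha b hb

lemma IsComponent.mem_of_adj {κ : SimpleGraph Pt} {Y C : Set Pt} (hC : IsComponent κ Y C)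
    {x y : Pt} (hx : x ∈ C) (hy : y ∈ Y) (hxy : κ.Adj x y) : y ∈ C := by
  have h := hC.2.2 (y := insert y C)
    ⟨Set.insert_subset hy hC.2.1.1, hC.2.1.2.insert hx hxy⟩ (Set.subset_insert _ _)
  exact h (Set.mem_insert _ _)

/-- A point of `Y` lies in a component, which is contained in every subset of `Y` that contains
the point and is closed under adjacency in `Y`. -/
lemma exists_isComponent {κ : SimpleGraph Pt} {Y T : Set Pt} {q : Pt} (hq : q ∈ Y) (hqT : q ∈ T)
    (hT : ∀ x ∈ T, x ∈ Y → ∀ y ∈ Y, κ.Adj x y → y ∈ T) :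
    ∃ C, IsComponent κ Y C ∧ q ∈ C ∧ C ⊆ T := by
  let R : Pt → Pt → Prop := fun a b => κ.Adj a b ∧ b ∈ Y
  let C : Set Pt := {y | Relation.ReflTransGen R q y}
  have hqC : q ∈ C := Relation.ReflTransGen.refl
  have hCY : C ⊆ Y := by
    intro y hy
    rcases Relation.ReflTransGen.cases_tail hy with h | ⟨_, _, h⟩
    · exact h ▸ hq
    · exact h.2
  have hfrom : ∀ y ∈ C, Relation.ReflTransGen (fun a b => κ.Adj a b ∧ b ∈ C) q y := by
    intro y hy
    induction hy with
    | refl => exact Relation.ReflTransGen.refl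
    | @tail b c hb hc ih => exact ih.tail ⟨hc.1, Relation.ReflTransGen.tail hb hc⟩
  have hto : ∀ y ∈ C, Relation.ReflTransGen (fun a b => κ.Adj a b ∧ b ∈ C) y q := by
    intro y hy
    induction hy with
    | refl => exact Relation.ReflTransGen.refl
    | @tail b c hb hc ih => exact Relation.ReflTransGen.head ⟨hc.1.symm, hb⟩ ih
  refine ⟨C, ⟨⟨q, hqC⟩, ⟨hCY, dConnected_iff.2 fun x hx y hy => (hto x hx).trans (hfrom y hy)⟩,
    ?_⟩, hqC, ?_⟩
  · rintro B ⟨hBY, hB⟩ hCB y hy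
    exact (dConnected_iff.1 hB q (hCB hqC) y hy).lift id fun a b h => ⟨h.1, hBY h.2⟩
  · intro y hy
    induction hy with
    | refl => exact hqT
    | @tail b c hb hc ih => exact hT b ih (hCY hb) c hc.2 hc.1

/-- The image of an adjacent pair is a connected set of at most two points; conversely, a path is
mapped to a path with possible pauses. -/
lemma dContinuous_iff {κ : SimpleGraph Pt} {X : Set Pt} {f : X → X} :
    DContinuous κ X f ↔
      ∀ x y : X, κ.Adj (x : Pt) y → (f x : Pt) = f y ∨ κ.Adj (f x : Pt) (f y) := by
  constructor
  · intro hf x y hxy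
    have h1 : DConnected κ (Subtype.val '' ({x, y} : Set X)) := by
      have h0 : DConnected κ {(x : Pt)} := by
        rw [dConnected_iff]
        rintro a rfl b rfl
        exact Relation.ReflTransGen.refl
      rw [Set.image_pair, Set.pair_comm]
      exact h0.insert (Set.mem_singleton _) hxy
    have h2 := hf _ h1
    rw [Set.image_pair, Set.image_pair, dConnected_iff] at h2
    rcases Relation.ReflTransGen.cases_head (h2 (f x) (by simp) (f y) (by simp))
      with h | ⟨c, ⟨hc, hm⟩, _⟩
    · exact Or.inl h
    · rcases hm with rfl | rfl
      · exact absurd hc (κ.irrefl)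
      · exact Or.inr hc
  · intro hf A hA
    rw [dConnected_iff] at hA ⊢
    rintro _ ⟨_, ⟨x, hx, rfl⟩, rfl⟩ _ ⟨_, ⟨y, hy, rfl⟩, rfl⟩
    have h := hA x ⟨x, hx, rfl⟩ y ⟨y, hy, rfl⟩
    generalize hz : (y : Pt) = z at h
    induction h generalizing y with
    | refl => rw [Subtype.ext hz]
    | @tail b c hb hc ih =>
      subst hz
      have hbA : b ∈ Subtype.val '' A := by
        rcases Relation.ReflTransGen.cases_tail hb with h | ⟨_, _, h⟩
        · exact h ▸ ⟨x, hx, rfl⟩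
        · exact h.2
      obtain ⟨w, hw, rfl⟩ := hbA
      rcases hf w y hc.1 with h | h
      · rw [← h]; exact ih w hw rfl
      · exact (ih w hw rfl).tail ⟨h, _, ⟨y, hy, rfl⟩, rfl⟩

/-! ### Rigidity of straight segments -/

lemma linear_le_of_abs_add_abs_le {a b c : ℤ} (h : |a| + |b| ≤ c) :
    a + b ≤ c ∧ a - b ≤ c ∧ -a + b ≤ c ∧ -a - b ≤ c := by
  have := le_abs_self a
  have := neg_le_abs a
  have := le_abs_self b
  have := neg_le_abs b
  refine ⟨?_, ?_, ?_, ?_⟩ <;> linarith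

lemma eq_of_abs_add_abs_eq_one {u : Pt} (hu : |u.1| + |u.2| = 1) :
    u = (1, 0) ∨ u = (-1, 0) ∨ u = (0, 1) ∨ u = (0, -1) := by
  obtain ⟨a, b⟩ := u
  simp only [Prod.mk.injEq] at *
  grind

/-- Continuity does not lengthen paths, and the ℓ¹ distance is at most the length of any path. -/
lemma l1_le_of_path {X : Set Pt} {f : X → X} (hf : DContinuous c1 X f) (g : ℕ → X) (n : ℕ)
    (hg : ∀ k < n, c1.Adj (g k : Pt) (g (k + 1))) :
    |(f (g n) : Pt).1 - (f (g 0) : Pt).1| + |(f (g n) : Pt).2 - (f (g 0) : Pt).2| ≤ n := by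
  induction n with
  | zero => simp
  | succ n ih =>
    have h1 := ih fun k hk => hg k (by omega)
    have h2 : |(f (g n) : Pt).1 - (f (g (n + 1)) : Pt).1|
        + |(f (g n) : Pt).2 - (f (g (n + 1)) : Pt).2| ≤ 1 := by
      rcases dContinuous_iff.1 hf _ _ (hg n (by omega)) with h | h
      · rw [h]; simp
      · exact le_of_eq h
    push_cast
    grind

/-- A continuous map which fixes both ends of a horizontal or vertical segment of `X` fixes the
whole segment. -/
lemma fixes_segment {X : Set Pt} {f : X → X} (hf : DContinuous c1 X f) {p u : Pt}
    (hu : |u.1| + |u.2| = 1) {n : ℕ} (hX : ∀ k ≤ n, p + (k : ℤ) • u ∈ X)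
    (h0 : ∀ x : X, (x : Pt) = p → f x = x)
    (hn : ∀ x : X, (x : Pt) = p + (n : ℤ) • u → f x = x)
    {k : ℕ} (hk : k ≤ n) (x : X) (hx : (x : Pt) = p + (k : ℤ) • u) : f x = x := by
  -- Capping the index at `n` makes the path total on `ℕ`; only indices up to `n` matter.
  let g : ℕ → X := fun j => ⟨p + ((min j n : ℕ) : ℤ) • u, hX _ (min_le_right _ _)⟩
  have hgv : ∀ j ≤ n, (g j : Pt) = p + (j : ℤ) • u := fun j hj => by
    simp only [g, min_eq_left hj]
  have hadj : ∀ j < n, c1.Adj (g j : Pt) (g (j + 1)) := by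
    intro j hj
    rw [hgv j hj.le, hgv (j + 1) hj]
    change |_| + |_| = (1 : ℤ)
    have e1 : (p + (j : ℤ) • u).1 - (p + ((j + 1 : ℕ) : ℤ) • u).1 = -u.1 := by
      simp; ring
    have e2 : (p + (j : ℤ) • u).2 - (p + ((j + 1 : ℕ) : ℤ) • u).2 = -u.2 := by
      simp; ring
    rw [e1, e2, abs_neg, abs_neg, hu]
  have hxk : x = g k := Subtype.ext (by rw [hx, hgv k hk])
  have f0 : (f (g 0) : Pt) = p := by
    rw [h0 (g 0) (by rw [hgv 0 (by omega)]; simp), hgv 0 (by omega)]; simp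
  have fn : (f (g n) : Pt) = p + (n : ℤ) • u := by
    rw [hn (g n) (hgv n le_rfl), hgv n le_rfl]
  have a1 := l1_le_of_path hf g k fun j hj => hadj j (by omega)
  have a2 := l1_le_of_path hf (fun j => g (k + j)) (n - k) fun j hj => hadj (k + j) (by omega)
  simp only [Nat.add_sub_cancel' hk, add_zero] at a2
  rw [f0] at a1
  rw [fn, Nat.cast_sub hk] at a2
  rw [hxk]
  apply Subtype.ext
  rw [hgv k hk]
  generalize (f (g k) : Pt) = y at *
  -- The image is within ℓ¹ distance `k` of one end and `n - k` of the other. The coordinate along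
  -- `u` uses up both distances, so nothing is left for the other coordinate.
  have b1 := linear_le_of_abs_add_abs_le a1
  have b2 := linear_le_of_abs_add_abs_le a2
  rcases eq_of_abs_add_abs_eq_one hu with rfl | rfl | rfl | rfl <;>
  simp only [Prod.fst_add, Prod.snd_add, Prod.smul_fst, Prod.smul_snd, smul_eq_mul, mul_one,
    mul_zero, mul_neg] at b1 b2 <;>
  apply Prod.ext <;>
  simp only [Prod.fst_add, Prod.snd_add, Prod.smul_fst, Prod.smul_snd, smul_eq_mul, mul_one,
    mul_zero, mul_neg] <;> omega

/-! ### The interior of a bounding curve -/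

lemma IsBoundingCurve.exists_interior {S : ClosedCurve} {X : Set Pt} (h : IsBoundingCurve S X) :
    ∃ F : Set Pt, F.Finite ∧ X = S.carrier ∪ F ∧ IsComponent c1 S.carrierᶜ F ∧
      ∀ C, IsComponent c1 S.carrierᶜ C → C.Finite → C = F := by
  obtain ⟨F, I, hF, hI, hC, hX⟩ := h
  refine ⟨F, hF, hX, ?_, fun C h1 h2 => ?_⟩
  · have : F ∈ ({F, I} : Set (Set Pt)) := Or.inl rfl
    rwa [← hC] at this
  · have : C ∈ ({F, I} : Set (Set Pt)) := hC ▸ h1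
    rcases this with h | h
    · exact h
    · exact absurd h2 (h ▸ hI)

lemma c1_adj_add {p u : Pt} (hu : |u.1| + |u.2| = 1) : c1.Adj p (p + u) := by
  change |_| + |_| = (1 : ℤ)
  simpa using hu

lemma c1_adj_iff {p q : Pt} : c1.Adj p q ↔ |(q - p).1| + |(q - p).2| = 1 := by
  change |_| + |_| = (1 : ℤ) ↔ _
  rw [abs_sub_comm p.1, abs_sub_comm p.2]
  rfl

lemma interior_neighbor_mem {S : ClosedCurve} {X F : Set Pt} (hX : X = S.carrier ∪ F)
    (hF : IsComponent c1 S.carrierᶜ F) {x y : Pt} (hx : x ∈ F) (hxy : c1.Adj x y) : y ∈ X := by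
  rw [hX]
  by_cases hy : y ∈ S.carrier
  · exact Or.inl hy
  · exact Or.inr (hF.mem_of_adj hx hy hxy)

/-- A ray from an interior point meets the curve, and stays in the disk up to there. -/
lemma exists_ray {S : ClosedCurve} {X F : Set Pt} (hfin : F.Finite) (hX : X = S.carrier ∪ F)
    (hF : IsComponent c1 S.carrierᶜ F) {x u : Pt} (hx : x ∈ F) (hu : |u.1| + |u.2| = 1) :
    ∃ m : ℕ, 0 < m ∧ x + (m : ℤ) • u ∈ S.carrier ∧ ∀ k ≤ m, x + (k : ℤ) • u ∈ X := by
  have hu0 : u ≠ 0 := by rintro rfl; simp at hu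
  have hex : ∃ m : ℕ, x + (m : ℤ) • u ∉ F := by
    by_contra! h
    refine Set.infinite_of_injective_forall_mem (f := fun m : ℕ => x + (m : ℤ) • u) ?_ h hfin
    intro a b hab
    have h1 : (a : ℤ) • u = (b : ℤ) • u := add_left_cancel hab
    exact_mod_cast smul_left_injective ℤ hu0 h1
  classical
  have hm := Nat.find_spec hex
  have hlt : ∀ k < Nat.find hex, x + (k : ℤ) • u ∈ F := fun k hk =>
    not_not.1 (Nat.find_min hex hk)
  set m := Nat.find hex
  have hm0 : 0 < m := by
    rcases Nat.eq_zero_or_pos m with h | h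
    · rw [h] at hm; simp [hx] at hm
    · exact h
  have hmX : x + (m : ℤ) • u ∈ X := by
    -- The first point of the ray outside `F` still has its predecessor in `F`, so it must be on the
    -- curve.
    have h1 := interior_neighbor_mem hX hF (hlt (m - 1) (by omega)) (c1_adj_add hu)
    have h2 : x + ((m - 1 : ℕ) : ℤ) • u + u = x + (m : ℤ) • u := by
      rw [Nat.cast_sub hm0, add_assoc]
      congr 1
      rw [Nat.cast_one, sub_smul, one_smul, sub_add_cancel]
    rwa [h2] at h1
  refine ⟨m, hm0, ?_, fun k hk => ?_⟩
  · rw [hX] at hmX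
    exact hmX.resolve_right hm
  · rcases hk.lt_or_eq with h | h
    · rw [hX]; exact Or.inr (hlt k h)
    · rw [h]; exact hmX

/-! ### Sides of a closed curve -/

namespace ClosedCurve

variable (S : ClosedCurve)

lemma pt_mem (i : ℤ) : S.pt i ∈ S.carrier := ⟨i, rfl⟩

lemma pt_succ (i : ℤ) : S.pt (i + 1) = S.pt i + S.step i := by
  simp [step]

lemma step_periodic : Function.Periodic S.step (S.len : ℤ) := by
  intro i
  rw [step, step, add_right_comm, S.periodic, S.periodic]

lemma step_ne_zero (i : ℤ) : S.step i ≠ 0 := fun h =>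
  (S.adj i).1 (sub_eq_zero.1 h).symm

lemma step_bounds (i : ℤ) :
    (-1 ≤ (S.step i).1 ∧ (S.step i).1 ≤ 1) ∧ (-1 ≤ (S.step i).2 ∧ (S.step i).2 ≤ 1) ∧
      ((S.step i).1 ≠ 0 ∨ (S.step i).2 ≠ 0) := by
  obtain ⟨-, h1, h2⟩ := S.adj i
  rw [abs_sub_comm] at h1 h2
  refine ⟨abs_le.1 h1, abs_le.1 h2, ?_⟩
  by_contra! h
  exact S.step_ne_zero i (Prod.ext h.1 h.2)

lemma isAxial_or_isSlanted (i : ℤ) : IsAxial (S.step i) ∨ IsSlanted (S.step i) := by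
  obtain ⟨h1, h2, -⟩ := S.step_bounds i
  unfold IsAxial IsSlanted
  rw [← abs_le] at h1 h2
  grind

lemma pt_add_of_step_eq {a : ℤ} {d : Pt} (n : ℕ) (h : ∀ k < n, S.step (a + k) = d) :
    S.pt (a + n) = S.pt a + (n : ℤ) • d := by
  induction n with
  | zero => simp
  | succ n ih =>
    have h1 := ih fun k hk => h k (by omega)
    push_cast
    rw [← add_assoc, S.pt_succ, h1, h n (by omega), add_smul, one_smul, add_assoc]

lemma exists_step_add_ne (i : ℤ) : ∃ n : ℕ, S.step (i + n) ≠ S.step i := by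
  by_contra! h
  -- Equal steps over a whole period would add up to a nonzero translation, but the curve closes up.
  have h1 := S.pt_add_of_step_eq S.len fun k _ => h k
  rw [S.periodic] at h1
  have h2 : (S.len : ℤ) • S.step i = 0 := by simpa using h1.symm
  rcases smul_eq_zero.1 h2 with h3 | h3
  · have := S.len_pos; omega
  · exact S.step_ne_zero i h3

lemma exists_step_sub_ne (i : ℤ) : ∃ n : ℕ, S.step (i - n) ≠ S.step i := by
  obtain ⟨n, hn⟩ := S.exists_step_add_ne i
  have hl : 1 ≤ S.len := S.len_pos
  -- Modulo the period, going back by this amount is going forward by `n`.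
  refine ⟨n * S.len - n, ?_⟩
  rw [Nat.cast_sub (Nat.le_mul_of_pos_right n hl)]
  have h := S.step_periodic.int_mul n (i - ((n * S.len : ℕ) - n))
  rw [← h]
  convert hn using 2
  push_cast
  ring

lemma exists_isSide (i : ℤ) : ∃ a b, S.IsSide a b ∧ a ≤ i ∧ i < b := by
  classical
  have h1 := S.exists_step_add_ne i
  have h2 := S.exists_step_sub_ne i
  have h1s := Nat.find_spec h1
  have h2s := Nat.find_spec h2
  have h1m : ∀ k < Nat.find h1, S.step (i + k) = S.step i := fun k hk =>
    not_not.1 (Nat.find_min h1 hk)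
  have h2m : ∀ k < Nat.find h2, S.step (i - k) = S.step i := fun k hk =>
    not_not.1 (Nat.find_min h2 hk)
  set n := Nat.find h1
  set m := Nat.find h2
  have hn : 0 < n := by
    rcases Nat.eq_zero_or_pos n with h | h
    · rw [h] at h1s; simp at h1s
    · exact h
  have hm : 0 < m := by
    rcases Nat.eq_zero_or_pos m with h | h
    · rw [h] at h2s; simp at h2s
    · exact h
  have hc : ∀ j, i - m < j → j < i + n → S.step j = S.step i := by
    intro j hj1 hj2
    rcases le_total i j with h | h
    · have := h1m (j - i).toNat (by omega)
      rwa [Int.toNat_of_nonneg (by omega), add_sub_cancel] at this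
    · have := h2m (i - j).toNat (by omega)
      rwa [Int.toNat_of_nonneg (by omega), sub_sub_cancel] at this
  have ha : S.step (i - m + 1) = S.step i := hc _ (by omega) (by omega)
  refine ⟨i - m + 1, i + n, ⟨by omega, fun j hj1 hj2 => ?_, ?_, ?_⟩, by omega, by omega⟩
  · rw [ha]; exact hc j (by omega) hj2
  · rw [ha, add_sub_cancel_right]; exact h2s
  · rw [ha]; exact h1s

variable {S}

lemma IsSide.pt_eq {a b : ℤ} (h : S.IsSide a b) {i : ℤ} (h1 : a ≤ i) (h2 : i ≤ b) :
    S.pt i = S.pt a + (i - a) • S.step a := by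
  have := S.pt_add_of_step_eq (a := a) (d := S.step a) (i - a).toNat fun k hk =>
    h.2.1 _ (by omega) (by omega)
  rwa [Int.toNat_of_nonneg (by omega), add_sub_cancel] at this

end ClosedCurve

/-! ### The set is freezing -/

lemma axialEndpoints_union_slantedPoints_subset (S : ClosedCurve) :
    axialEndpoints S ∪ slantedPoints S ⊆ S.carrier := by
  rintro x (⟨a, b, -, -, rfl | rfl⟩ | ⟨a, b, -, -, i, -, -, rfl⟩) <;> exact S.pt_mem _

lemma fixes_carrier {S : ClosedCurve} {X : Set Pt} (hSX : S.carrier ⊆ X) {f : X → X}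
    (hf : DContinuous c1 X f)
    (hA : ∀ x : X, (x : Pt) ∈ axialEndpoints S ∪ slantedPoints S → f x = x) (x : X)
    (hx : (x : Pt) ∈ S.carrier) : f x = x := by
  obtain ⟨i, hi⟩ := hx
  obtain ⟨a, b, hs, hai, hib⟩ := S.exists_isSide i
  rcases S.isAxial_or_isSlanted a with hd | hd
  · have hu : |(S.step a).1| + |(S.step a).2| = 1 := by
      obtain ⟨h1, h2, h3⟩ := S.step_bounds a
      rw [← abs_le] at h1 h2
      unfold IsAxial at hd
      grind
    refine fixes_segment hf (p := S.pt a) hu (n := (b - a).toNat) (k := (i - a).toNat)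
      (fun k hk => ?_) (fun y hy => hA y (Or.inl ⟨a, b, hs, hd, Or.inl hy⟩))
      (fun y hy => hA y (Or.inl ⟨a, b, hs, hd, Or.inr ?_⟩)) (by omega) x ?_
    · have := hs.pt_eq (i := a + k) (by omega) (by omega)
      rw [add_sub_cancel_left] at this
      rw [← this]
      exact hSX (S.pt_mem _)
    · rw [hy, hs.pt_eq hs.1.le le_rfl, Int.toNat_of_nonneg (by omega)]
    · rw [← hi, hs.pt_eq hai hib.le, Int.toNat_of_nonneg (by omega)]
  · exact hA x (Or.inr ⟨a, b, hs, hd, i, hai, hib.le, hi.symm⟩)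

/-- This holds for every digital disk, convex or not. -/
lemma isFreezingSet_axialEndpoints_union_slantedPoints {S : ClosedCurve} {X : Set Pt}
    (h : IsBoundingCurve S X) : IsFreezingSet c1 X (axialEndpoints S ∪ slantedPoints S) := by
  obtain ⟨F, hfin, hX, hF, -⟩ := h.exists_interior
  have hSX : S.carrier ⊆ X := hX ▸ Set.subset_union_left
  refine ⟨(axialEndpoints_union_slantedPoints_subset S).trans hSX, fun f hf hA => ?_⟩
  have hS := fixes_carrier hSX hf hA
  funext x
  by_cases hxS : (x : Pt) ∈ S.carrier
  · exact hS x hxS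
  have hxF : (x : Pt) ∈ F := by
    exact (hX.subset x.2).resolve_left hxS
  -- The two horizontal rays end on the curve, where the map is already the identity, and together
  -- they form a segment of the disk.
  obtain ⟨m, hm, hmS, hmX⟩ := exists_ray hfin hX hF hxF (u := (1, 0)) (by simp)
  obtain ⟨n, hn, hnS, hnX⟩ := exists_ray hfin hX hF hxF (u := (-1, 0)) (by simp)
  refine fixes_segment hf (p := (x : Pt) + (n : ℤ) • ((-1, 0) : Pt)) (u := (1, 0)) (by simp) (n := n + m)
    (k := n) (fun k hk => ?_) (fun y hy => hS y (hy ▸ hnS)) (fun y hy => hS y ?_) (by omega) x ?_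
  · rcases le_total k n with h | h
    · convert hnX (n - k) (by omega) using 1
      push_cast [Nat.cast_sub h]
      apply Prod.ext <;> simp
      ring
    · convert hmX (k - n) (by omega) using 1
      push_cast [Nat.cast_sub h]
      apply Prod.ext <;> simp
      ring
  · rw [hy]
    convert hmS using 1
    apply Prod.ext <;> simp
  · apply Prod.ext <;> simp

/-! ### Supporting lines -/

lemma hull_interior_nonempty {X : Set Pt} {x : Pt} (h0 : x ∈ X) (h1 : x + (1, 0) ∈ X)
    (h2 : x + (0, 1) ∈ X) : (interior (hull X)).Nonempty := by
  let U : Set (ℝ × ℝ) := {z | (x.1 : ℝ) < z.1 ∧ (x.2 : ℝ) < z.2 ∧ z.1 + z.2 < x.1 + x.2 + 1}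
  have hU : IsOpen U :=
    (isOpen_lt continuous_const continuous_fst).inter
      ((isOpen_lt continuous_const continuous_snd).inter
        (isOpen_lt (continuous_fst.add continuous_snd) continuous_const))
  refine ⟨(x.1 + 1 / 3, x.2 + 1 / 3), mem_interior.2 ⟨U, ?_, hU, ?_⟩⟩
  · rintro ⟨z1, z2⟩ ⟨hz1, hz2, hz⟩
    dsimp only at hz1 hz2 hz
    -- Barycentric coordinates in the triangle of the three given points.
    let w : Fin 3 → ℝ := ![x.1 + x.2 + 1 - z1 - z2, z1 - x.1, z2 - x.2]
    let v : Fin 3 → ℝ × ℝ := ![toReal x, toReal (x + (1, 0)), toReal (x + (0, 1))]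
    have h := (convex_convexHull ℝ (toReal '' X)).sum_mem (t := Finset.univ) (w := w) (z := v)
      (by
        intro i _
        fin_cases i <;> simp [w] <;> linarith)
      (by simp [w, Fin.sum_univ_three]; ring)
      (by
        intro i _
        apply subset_convexHull
        fin_cases i
        · exact ⟨x, h0, rfl⟩
        · exact ⟨_, h1, rfl⟩
        · exact ⟨_, h2, rfl⟩)
    change _ ∈ hull X at h
    convert h using 1
    rw [Fin.sum_univ_three]
    apply Prod.ext <;> simp [w, v, toReal] <;> ring
  · refine ⟨?_, ?_, ?_⟩ <;> dsimp only <;> linarith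

/-- A line through a segment of the frontier of the hull has the whole set on one side. -/
lemma cross_nonneg_or_nonpos_of_segment_subset_frontier {X : Set Pt} {p q : Pt} (hp : p ∈ X)
    (hq : q ∈ X) (hne : (interior (hull X)).Nonempty)
    (hseg : segment ℝ (toReal p) (toReal q) ⊆ frontier (hull X)) :
    (∀ x ∈ X, 0 ≤ cross (q - p) (x - p)) ∨ ∀ x ∈ X, cross (q - p) (x - p) ≤ 0 := by
  have hconv : Convex ℝ (hull X) := convex_convexHull ℝ _
  have hm := hseg (midpoint_mem_segment (𝕜 := ℝ) (toReal p) (toReal q))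
  -- A functional separating the midpoint from the open interior is bounded on `X` by its value at
  -- the midpoint, since `X` lies in the closure of the interior.
  obtain ⟨f, hf⟩ := geometric_hahn_banach_open_point hconv.interior isOpen_interior hm.2
  have hle : ∀ x ∈ X, f (toReal x) ≤ f (midpoint ℝ (toReal p) (toReal q)) := by
    intro x hx
    have h1 : toReal x ∈ closure (interior (hull X)) := by
      rw [hconv.closure_interior_eq_closure_of_nonempty_interior hne]
      exact subset_closure (subset_convexHull ℝ _ ⟨x, hx, rfl⟩)
    exact closure_minimal (fun a ha => (hf a ha).le)
      (isClosed_le f.continuous continuous_const) h1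
  have hf0 : ∀ a b : ℝ, f (a, b) = a * f (1, 0) + b * f (0, 1) := by
    intro a b
    have h : ((a, b) : ℝ × ℝ) = a • (1, 0) + b • (0, 1) := by
      apply Prod.ext <;> simp
    rw [h, map_add, map_smul, map_smul, smul_eq_mul, smul_eq_mul]
  obtain ⟨⟨z1, z2⟩, hz⟩ := hne
  have hz := hf _ hz
  have hmid : (midpoint ℝ (toReal p) (toReal q))
      = (((p.1 : ℝ) + q.1) / 2, ((p.2 : ℝ) + q.2) / 2) := by
    rw [midpoint_eq_smul_add]
    apply Prod.ext <;> simp [toReal] <;> ring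
  have hxs : ∀ x ∈ X, (x.1 : ℝ) * f (1, 0) + x.2 * f (0, 1)
      ≤ ((p.1 : ℝ) + q.1) / 2 * f (1, 0) + ((p.2 : ℝ) + q.2) / 2 * f (0, 1) := by
    intro x hx
    have := hle x hx
    rwa [hmid, toReal, hf0, hf0 (_ / 2)] at this
  rw [hmid, hf0, hf0 (_ / 2)] at hz
  set α := f (1, 0)
  set β := f (0, 1)
  have hp' := hxs p hp
  have hq' := hxs q hq
  -- The midpoint value is the average of the values at `p` and `q` and bounds both, so the
  -- functional vanishes on `q - p` and is proportional to the cross product with `q - p`.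
  have hpq : ((q.1 : ℝ) - p.1) * α + (q.2 - p.2) * β = 0 := by linarith
  have hxp : ∀ x ∈ X, ((x.1 : ℝ) - p.1) * α + (x.2 - p.2) * β ≤ 0 := fun x hx => by
    have := hxs x hx
    linarith
  have key1 : ∀ x : Pt, α * (cross (q - p) (x - p) : ℤ)
      = -((q.2 : ℝ) - p.2) * (((x.1 : ℝ) - p.1) * α + (x.2 - p.2) * β) := by
    intro x
    simp only [cross, Prod.fst_sub, Prod.snd_sub]
    push_cast
    linear_combination ((x.2 : ℝ) - p.2) * hpq
  have key2 : ∀ x : Pt, β * (cross (q - p) (x - p) : ℤ)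
      = ((q.1 : ℝ) - p.1) * (((x.1 : ℝ) - p.1) * α + (x.2 - p.2) * β) := by
    intro x
    simp only [cross, Prod.fst_sub, Prod.snd_sub]
    push_cast
    linear_combination -((x.1 : ℝ) - p.1) * hpq
  have hne : α ≠ 0 ∨ β ≠ 0 := by
    by_contra! h
    rw [h.1, h.2] at hz
    simp at hz
  have concl : ∀ γ δ : ℝ, γ ≠ 0 → (∀ x : Pt, γ * (cross (q - p) (x - p) : ℤ)
      = δ * (((x.1 : ℝ) - p.1) * α + (x.2 - p.2) * β)) →
      (∀ x ∈ X, 0 ≤ cross (q - p) (x - p)) ∨ ∀ x ∈ X, cross (q - p) (x - p) ≤ 0 := by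
    intro γ δ hγ hkey
    have hkey' : ∀ x : Pt, ((cross (q - p) (x - p) : ℤ) : ℝ)
        = δ / γ * (((x.1 : ℝ) - p.1) * α + (x.2 - p.2) * β) := fun x => by
      rw [div_mul_eq_mul_div, eq_div_iff hγ, mul_comm, hkey]
    rcases le_total (δ / γ) 0 with h | h
    · left
      intro x hx
      have := mul_nonneg_of_nonpos_of_nonpos h (hxp x hx)
      rw [← hkey'] at this
      exact_mod_cast this
    · right
      intro x hx
      have := mul_nonpos_of_nonneg_of_nonpos h (hxp x hx)
      rw [← hkey'] at this
      exact_mod_cast this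
  rcases hne with h | h
  · exact concl α _ h key1
  · exact concl β _ h key2

lemma cross_smul_left (n : ℤ) (u v : Pt) : cross (n • u) v = n * cross u v := by
  simp [cross]; ring

lemma cross_add_right (u v w : Pt) : cross u (v + w) = cross u v + cross u w := by
  simp [cross]; ring

lemma cross_neg_right (u v : Pt) : cross u (-v) = -cross u v := by
  simp [cross]; ring

lemma cross_sub_right (u v w : Pt) : cross u (v - w) = cross u v - cross u w := by
  simp [cross]; ring

lemma cross_smul_right (n : ℤ) (u v : Pt) : cross u (n • v) = n * cross u v := by
  simp [cross]; ring

lemma cross_self (u : Pt) : cross u u = 0 := by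
  simp [cross]; ring

lemma cross_comm (u v : Pt) : cross u v = -cross v u := by
  simp [cross]; ring

/-! ### The supporting lines all have the disk on the same hand -/

namespace ClosedCurve

variable {S : ClosedCurve}

/-- The set `X` is on the side of the `i`-th step of `S` given by the sign `ε`. -/
def Supports (S : ClosedCurve) (ε : ℤ) (X : Set Pt) (i : ℤ) : Prop :=
  ∀ x ∈ X, 0 ≤ ε * cross (S.step i) (x - S.pt i)

lemma supports_or_supports_neg {X : Set Pt} (hSX : S.carrier ⊆ X)
    (hne : (interior (hull X)).Nonempty)
    (hseg : ∀ a b, S.IsSide a b →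
      segment ℝ (toReal (S.pt a)) (toReal (S.pt b)) ⊆ frontier (hull X)) (ε i : ℤ) :
    S.Supports ε X i ∨ S.Supports (-ε) X i := by
  obtain ⟨a, b, hs, hai, hib⟩ := S.exists_isSide i
  have hb : S.pt b - S.pt a = (b - a) • S.step a := by
    rw [hs.pt_eq hs.1.le le_rfl, add_sub_cancel_left]
  have hi : S.step i = S.step a := hs.2.1 i hai hib
  have hx : ∀ x : Pt, cross (S.step i) (x - S.pt i) = cross (S.step a) (x - S.pt a) := by
    intro x
    rw [hi, hs.pt_eq hai hib.le, ← sub_sub, cross_sub_right, cross_smul_right, cross_self]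
    ring
  have hab : 0 < b - a := by have := hs.1; omega
  have hsgn : (∀ x ∈ X, 0 ≤ cross (S.step i) (x - S.pt i)) ∨
      ∀ x ∈ X, cross (S.step i) (x - S.pt i) ≤ 0 := by
    rcases cross_nonneg_or_nonpos_of_segment_subset_frontier (hSX (S.pt_mem a)) (hSX (S.pt_mem b))
      hne (hseg a b hs) with h | h
    · left
      intro x hxX
      have := h x hxX
      rw [hb, cross_smul_left] at this
      rw [hx]
      exact nonneg_of_mul_nonneg_right this hab
    · right
      intro x hxX
      have := h x hxX
      rw [hb, cross_smul_left] at this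
      rw [hx]
      exact nonpos_of_mul_nonpos_right this hab
  rcases hsgn with h | h <;> rcases le_total 0 ε with hε | hε
  · exact Or.inl fun x hx => mul_nonneg hε (h x hx)
  · exact Or.inr fun x hx => mul_nonneg (by omega) (h x hx)
  · exact Or.inr fun x hx => mul_nonneg_of_nonpos_of_nonpos (by omega) (h x hx)
  · exact Or.inl fun x hx => mul_nonneg_of_nonpos_of_nonpos hε (h x hx)

/-- A curve which has two points in a row that are not adjacent never reverses its direction. -/
lemma step_succ_ne_neg {p q : Pt} (hp : p ∈ S.carrier) (hq : q ∈ S.carrier)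
    (hpq : 1 < p.1 - q.1) (i : ℤ) : S.step (i + 1) ≠ -S.step i := by
  intro h
  have h1 : S.pt (i + 1 + 1) = S.pt i := by
    rw [S.pt_succ, h, S.pt_succ]; abel
  -- A reversal revisits a point after two steps, so the period divides two and the curve consists
  -- of at most two, adjacent, points.
  have h2 : i + 2 ≡ i [ZMOD S.len] := S.inj _ _ (by rw [← h1, add_assoc]; rfl)
  have h3 : (S.len : ℤ) ∣ 2 := by
    have := h2.symm.dvd
    simpa using this
  have hper : Function.Periodic S.pt 2 := by
    obtain ⟨c, hc⟩ := h3
    have : Function.Periodic S.pt (c * S.len) := (show Function.Periodic S.pt S.len from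
      S.periodic).int_mul c
    rwa [hc, mul_comm]
  obtain ⟨j, rfl⟩ := hp
  obtain ⟨k, rfl⟩ := hq
  have hp2 : ∀ n : ℤ, ∀ m, S.pt (m + n * 2) = S.pt m := fun n m => hper.int_mul n m
  rcases Int.even_or_odd' (j - k) with ⟨c, hc | hc⟩
  · have : j = k + c * 2 := by omega
    rw [this, hp2] at hpq
    simp at hpq
  · have : j = k + 1 + c * 2 := by omega
    rw [this, hp2, S.pt_succ] at hpq
    have := (S.step_bounds k).1.2
    simp at hpq
    omega

lemma cross_step_ne_zero {i j : ℤ} (h1 : S.step j ≠ S.step i) (h2 : S.step j ≠ -S.step i) :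
    cross (S.step i) (S.step j) ≠ 0 := by
  obtain ⟨a1, a2, a3⟩ := S.step_bounds i
  obtain ⟨b1, b2, b3⟩ := S.step_bounds j
  unfold cross
  generalize S.step i = d at *
  generalize S.step j = e at *
  obtain ⟨d1, d2⟩ := d
  obtain ⟨e1, e2⟩ := e
  simp only [ne_eq, Prod.mk.injEq, Prod.neg_mk] at *
  have hd1 : d1 = -1 ∨ d1 = 0 ∨ d1 = 1 := by omega
  have hd2 : d2 = -1 ∨ d2 = 0 ∨ d2 = 1 := by omega
  rcases hd1 with rfl | rfl | rfl <;> rcases hd2 with rfl | rfl | rfl <;> omega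

variable {X : Set Pt} {ε : ℤ}

lemma cross_step_succ_nonneg (hSX : S.carrier ⊆ X) {i : ℤ} (h : S.Supports ε X i) :
    0 ≤ ε * cross (S.step i) (S.step (i + 1)) := by
  have := h _ (hSX (S.pt_mem (i + 1 + 1)))
  rwa [S.pt_succ (i + 1), S.pt_succ i, add_assoc, add_sub_cancel_left, cross_add_right,
    cross_self, zero_add] at this

/-- If the sign changed at a turn, `S.pt i` and `S.pt (i + 2)` would give opposite inequalities for
the cross product of the two steps, making it zero. -/
lemma Supports.succ (hSX : S.carrier ⊆ X) (hε : ε ≠ 0)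
    (hor : ∀ i, S.Supports ε X i ∨ S.Supports (-ε) X i)
    (hrev : ∀ i, S.step (i + 1) ≠ -S.step i) {i : ℤ} (h : S.Supports ε X i) :
    S.Supports ε X (i + 1) := by
  by_cases hd : S.step (i + 1) = S.step i
  · intro x hx
    have := h x hx
    rwa [hd, S.pt_succ, ← sub_sub, cross_sub_right, cross_self, sub_zero]
  · refine (hor (i + 1)).resolve_right fun h' => ?_
    have h1 := cross_step_succ_nonneg hSX h
    have h2 := h' _ (hSX (S.pt_mem i))
    rw [S.pt_succ i, sub_add_cancel_left, cross_neg_right, cross_comm, neg_neg] at h2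
    have h3 : ε * cross (S.step i) (S.step (i + 1)) = 0 := by linarith
    rcases mul_eq_zero.1 h3 with h4 | h4
    · exact hε h4
    · exact cross_step_ne_zero hd (hrev i) h4

lemma exists_supports (hSX : S.carrier ⊆ X)
    (hor : ∀ ε i, S.Supports ε X i ∨ S.Supports (-ε) X i)
    (hrev : ∀ i, S.step (i + 1) ≠ -S.step i) :
    ∃ ε : ℤ, (ε = 1 ∨ ε = -1) ∧ ∀ i, S.Supports ε X i := by
  obtain ⟨ε, hε, h0⟩ : ∃ ε : ℤ, (ε = 1 ∨ ε = -1) ∧ S.Supports ε X 0 := by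
    rcases hor 1 0 with h | h
    · exact ⟨1, Or.inl rfl, h⟩
    · exact ⟨-1, Or.inr rfl, h⟩
  have hnat : ∀ n : ℕ, S.Supports ε X n := by
    intro n
    induction n with
    | zero => exact h0
    | succ n ih =>
      push_cast
      exact ih.succ hSX (by omega) (hor ε) hrev
  refine ⟨ε, hε, fun i x hx => ?_⟩
  have hl := S.len_pos
  have h1 := hnat (i % S.len).toNat x hx
  rw [Int.toNat_of_nonneg (Int.emod_nonneg _ (by omega))] at h1
  have h2 : i = i % S.len + (i / S.len) * S.len := by
    rw [mul_comm]; exact (Int.emod_add_mul_ediv i _).symm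
  have h3 : S.pt i = S.pt (i % S.len) := by
    conv_lhs => rw [h2]
    exact (show Function.Periodic S.pt S.len from S.periodic).int_mul _ _
  have h4 : S.step i = S.step (i % S.len) := by
    conv_lhs => rw [h2]
    exact S.step_periodic.int_mul _ _
  rwa [h3, h4]

/-- The lattice points of the polygon cut out by the supporting lines along `S`. -/
def polygon (S : ClosedCurve) (ε : ℤ) : Set Pt :=
  {q | ∀ i, 0 ≤ ε * cross (S.step i) (q - S.pt i)}

lemma cross_step_succ_pos (hSX : S.carrier ⊆ X) (hsup : ∀ i, S.Supports ε X i)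
    (hrev : ∀ i, S.step (i + 1) ≠ -S.step i) (hε : ε ≠ 0) {i : ℤ}
    (hd : S.step (i + 1) ≠ S.step i) : 0 < ε * cross (S.step i) (S.step (i + 1)) :=
  lt_of_le_of_ne (cross_step_succ_nonneg hSX (hsup i))
    (mul_ne_zero hε (cross_step_ne_zero hd (hrev i))).symm

end ClosedCurve

/-! ### The disk as the set of lattice points of a polygon -/

namespace ClosedCurve

variable {S : ClosedCurve} {X : Set Pt} {ε : ℤ}

/-- A point of the polygon on the line of a step lies on the side containing this step. -/
lemma mem_carrier_of_mem_polygon (hSX : S.carrier ⊆ X) (hsup : ∀ i, S.Supports ε X i)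
    (hrev : ∀ i, S.step (i + 1) ≠ -S.step i) (hε : ε ≠ 0) {q : Pt} (hq : q ∈ S.polygon ε) {i : ℤ}
    (hi : cross (S.step i) (q - S.pt i) = 0) : q ∈ S.carrier := by
  obtain ⟨a, b, hs, hai, hib⟩ := S.exists_isSide i
  have hab := hs.1
  rw [hs.2.1 i hai hib, hs.pt_eq hai hib.le, ← sub_sub, cross_sub_right, cross_smul_right,
    cross_self, mul_zero, sub_zero] at hi
  obtain ⟨t, ht⟩ : ∃ t : ℤ, q = S.pt a + t • S.step a := by
    obtain ⟨h1, h2, h3⟩ := S.step_bounds a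
    have hmul : ∀ w d : Pt, (-1 ≤ d.1 ∧ d.1 ≤ 1) → (-1 ≤ d.2 ∧ d.2 ≤ 1) → (d.1 ≠ 0 ∨ d.2 ≠ 0) →
        cross d w = 0 → ∃ t : ℤ, w = t • d := by
      rintro ⟨w1, w2⟩ ⟨d1, d2⟩ h1 h2 h3 h
      simp only [cross] at *
      have hd1 : d1 = -1 ∨ d1 = 0 ∨ d1 = 1 := by omega
      have hd2 : d2 = -1 ∨ d2 = 0 ∨ d2 = 1 := by omega
      -- A nonzero coordinate of `d` is `1` or `-1`, so multiplying by it is dividing by it.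
      refine ⟨if d1 = 0 then w2 * d2 else w1 * d1, ?_⟩
      rcases hd1 with rfl | rfl | rfl <;> rcases hd2 with rfl | rfl | rfl <;>
      apply Prod.ext <;> simp <;> omega
    obtain ⟨t, ht⟩ := hmul _ _ h1 h2 h3 hi
    exact ⟨t, by rw [← ht, add_sub_cancel]⟩
  have hb1 : S.step (b - 1) = S.step a := hs.2.1 _ (by omega) (by omega)
  have hpos1 : 0 < ε * cross (S.step a) (S.step b) := by
    have := cross_step_succ_pos hSX hsup hrev hε (i := b - 1)
      (by rw [hb1, sub_add_cancel]; exact hs.2.2.2)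
    rwa [hb1, sub_add_cancel] at this
  have hpos2 : 0 < ε * cross (S.step (a - 1)) (S.step a) := by
    have := cross_step_succ_pos hSX hsup hrev hε (i := a - 1)
      (by rw [sub_add_cancel]; exact hs.2.2.1.symm)
    rwa [sub_add_cancel] at this
  -- The lines of the next and of the previous side cut this line exactly at the two endpoints.
  have ht1 : t ≤ b - a := by
    have h := hq b
    rw [ht, hs.pt_eq hab.le le_rfl, add_sub_add_left_eq_sub, ← sub_smul, cross_smul_right,
      cross_comm] at h
    by_contra! hc
    nlinarith
  have ht0 : 0 ≤ t := by
    have h := hq (a - 1)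
    have ha : S.pt a = S.pt (a - 1) + S.step (a - 1) := by
      rw [← S.pt_succ, sub_add_cancel]
    rw [ht, ha, add_assoc, add_sub_cancel_left, cross_add_right, cross_self, zero_add,
      cross_smul_right] at h
    by_contra! hc
    nlinarith
  refine ⟨a + t, ?_⟩
  rw [hs.pt_eq (by omega) (by omega), ht, add_sub_cancel_left]

/-- The integral linear form of a step changes by at most one along a `c1`-edge. It cannot become
negative without having been zero, and a polygon point where it is zero is on the curve. -/
lemma mem_polygon_of_adj (hSX : S.carrier ⊆ X) (hsup : ∀ i, S.Supports ε X i)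
    (hrev : ∀ i, S.step (i + 1) ≠ -S.step i) (hε : ε = 1 ∨ ε = -1) {x y : Pt}
    (hx : x ∈ S.polygon ε) (hxS : x ∉ S.carrier) (hxy : c1.Adj x y) : y ∈ S.polygon ε := by
  intro i
  by_contra! hc
  refine hxS (mem_carrier_of_mem_polygon hSX hsup hrev (by omega) hx (i := i) ?_)
  have h0 := hx i
  have hy : y - S.pt i = (x - S.pt i) + (y - x) := by abel
  rw [hy, cross_add_right] at hc
  have hb : -1 ≤ cross (S.step i) (y - x) ∧ cross (S.step i) (y - x) ≤ 1 := by
    obtain ⟨h1, h2, -⟩ := S.step_bounds i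
    rcases eq_of_abs_add_abs_eq_one (c1_adj_iff.1 hxy) with h | h | h | h <;> rw [h] <;>
    simp only [cross] <;> omega
  rcases hε with rfl | rfl <;> omega

lemma sum_step (i : ℤ) (n : ℕ) : ∑ j ∈ Finset.range n, S.step (i + j) = S.pt (i + n) - S.pt i := by
  induction n with
  | zero => simp
  | succ n ih =>
    rw [Finset.sum_range_succ, ih, step]
    push_cast
    rw [add_assoc i]
    abel

/-- The steps of a closed curve sum to zero, so the sum of their linear forms is constant in `q`. On
the polygon all of them are nonnegative, so each is bounded by that constant. -/
lemma exists_polygon_bound (S : ClosedCurve) (ε i : ℤ) :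
    ∃ K, ∀ q ∈ S.polygon ε, ε * cross (S.step i) (q - S.pt i) ≤ K := by
  refine ⟨-∑ j ∈ Finset.range S.len, ε * cross (S.step (i + j)) (S.pt (i + j)), fun q hq => ?_⟩
  have h1 : ∑ j ∈ Finset.range S.len, cross (S.step (i + j)) q = 0 := by
    have h := S.sum_step i S.len
    rw [S.periodic, sub_self] at h
    have h2 : ∑ j ∈ Finset.range S.len, cross (S.step (i + j)) q
        = cross (∑ j ∈ Finset.range S.len, S.step (i + j)) q := by
      simp only [cross, Prod.fst_sum, Prod.snd_sum, Finset.sum_mul, Finset.sum_sub_distrib]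
    rw [h2, h]
    simp [cross]
  have h2 : ∑ j ∈ Finset.range S.len, ε * cross (S.step (i + j)) (q - S.pt (i + j))
      = -∑ j ∈ Finset.range S.len, ε * cross (S.step (i + j)) (S.pt (i + j)) := by
    simp only [cross_sub_right, mul_sub, Finset.sum_sub_distrib]
    rw [← Finset.mul_sum, h1]
    ring
  rw [← h2]
  have h3 := Finset.single_le_sum (s := Finset.range S.len)
    (f := fun j : ℕ => ε * cross (S.step (i + j)) (q - S.pt (i + j))) (fun j _ => hq _)
    (Finset.mem_range.2 S.len_pos)
  simpa using h3

lemma polygon_finite (hrev : ∀ i, S.step (i + 1) ≠ -S.step i) (hε : ε ≠ 0) :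
    (S.polygon ε).Finite := by
  obtain ⟨a, b, hs, -, -⟩ := S.exists_isSide 0
  have hcr : cross (S.step (a - 1)) (S.step a) ≠ 0 :=
    cross_step_ne_zero hs.2.2.1.symm (by simpa using hrev (a - 1))
  obtain ⟨K, hK⟩ := S.exists_polygon_bound ε a
  obtain ⟨L, hL⟩ := S.exists_polygon_bound ε (a - 1)
  -- The forms of two non-parallel steps serve as coordinates, each with a bounded range.
  let g : Pt → ℤ × ℤ := fun q =>
    (ε * cross (S.step a) (q - S.pt a), ε * cross (S.step (a - 1)) (q - S.pt (a - 1)))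
  refine Set.Finite.of_finite_image (f := g)
    (((Set.finite_Icc 0 K).prod (Set.finite_Icc 0 L)).subset ?_) ?_
  · rintro _ ⟨q, hq, rfl⟩
    exact ⟨⟨hq a, hK q hq⟩, ⟨hq _, hL q hq⟩⟩
  · intro p _ q _ hpq
    have h1 := mul_left_cancel₀ hε (congrArg Prod.fst hpq)
    have h2 := mul_left_cancel₀ hε (congrArg Prod.snd hpq)
    simp only [cross_sub_right, sub_left_inj] at h1 h2
    simp only [cross] at h1 h2 hcr
    apply Prod.ext
    · apply mul_left_cancel₀ hcr
      linear_combination (S.step a).1 * h2 - (S.step (a - 1)).1 * h1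
    · apply mul_left_cancel₀ hcr
      linear_combination (S.step a).2 * h2 - (S.step (a - 1)).2 * h1

/-- A digitally convex disk is the set of lattice points of its polygon. -/
lemma eq_polygon {F : Set Pt} (hX : X = S.carrier ∪ F)
    (hF : ∀ C, IsComponent c1 S.carrierᶜ C → C.Finite → C = F) (hsup : ∀ i, S.Supports ε X i)
    (hrev : ∀ i, S.step (i + 1) ≠ -S.step i) (hε : ε = 1 ∨ ε = -1) : X = S.polygon ε := by
  have hSX : S.carrier ⊆ X := hX ▸ Set.subset_union_left
  apply Set.Subset.antisymm
  · exact fun x hx i => hsup i x hx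
  · intro q hq
    by_cases hqS : q ∈ S.carrier
    · exact hSX hqS
    -- The component of `q` off the curve cannot leave the finite polygon, so it is the finite
    -- component.
    obtain ⟨C, hC, hqC, hCT⟩ := exists_isComponent (κ := c1) (Y := S.carrierᶜ) hqS hq
      fun x hx hxS y _ hxy => mem_polygon_of_adj hSX hsup hrev hε hx hxS hxy
    rw [hX, ← hF C hC ((polygon_finite hrev (by omega)).subset hCT)]
    exact Or.inr hqC

end ClosedCurve

/-! ### Minimality -/

/-- If the neighbors of `p` are among a different point `p'` and its neighbors, then `p` can be
moved to `p'`. -/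
lemma not_isFreezingSet_of_move {X B : Set Pt} {p p' : Pt} (hp : p ∈ X) (hp' : p' ∈ X)
    (hne : p' ≠ p) (h : ∀ q ∈ X, c1.Adj p q → q = p' ∨ c1.Adj p' q) (hB : p ∉ B) :
    ¬ IsFreezingSet c1 X B := by
  classical
  rintro ⟨-, hfr⟩
  let f : X → X := fun x => if (x : Pt) = p then ⟨p', hp'⟩ else x
  have hfp : ∀ x : X, (x : Pt) = p → f x = ⟨p', hp'⟩ := fun x hx => if_pos hx
  have hfn : ∀ x : X, (x : Pt) ≠ p → f x = x := fun x hx => if_neg hx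
  have hf : f = id := by
    refine hfr f (dContinuous_iff.2 fun x y hxy => ?_) fun x hx => hfn x fun h => hB (h ▸ hx)
    by_cases hx : (x : Pt) = p
    · have hy : (y : Pt) ≠ p := fun hy => hxy.ne (hx.trans hy.symm)
      rw [hfp x hx, hfn y hy]
      exact (h y y.2 (hx ▸ hxy)).imp Eq.symm id
    · by_cases hy : (y : Pt) = p
      · rw [hfn x hx, hfp y hy]
        exact (h x x.2 (hy ▸ hxy.symm)).imp id SimpleGraph.Adj.symm
      · rw [hfn x hx, hfn y hy]
        exact Or.inr hxy
  have h1 := hfp ⟨p, hp⟩ rfl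
  rw [hf] at h1
  exact hne (congrArg Subtype.val h1).symm

/-- Without opposite neighbors, `p` has at most two. It moves to the fourth corner of their square
if there are two, onto the neighbor if there is one, and to `r` if there is none. -/
lemma not_isFreezingSet_of_neighbors {X B : Set Pt} {p r : Pt} (hp : p ∈ X) (hr : r ∈ X)
    (hrp : r ≠ p) (hopp : ∀ u : Pt, |u.1| + |u.2| = 1 → p + u ∈ X → p - u ∉ X)
    (hperp : ∀ u v : Pt, |u.1| + |u.2| = 1 → |v.1| + |v.2| = 1 → cross u v ≠ 0 →
      p + u ∈ X → p + v ∈ X → p + u + v ∈ X) (hB : p ∉ B) : ¬ IsFreezingSet c1 X B := by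
  have hnb : ∀ q ∈ X, c1.Adj p q → ∃ u : Pt, |u.1| + |u.2| = 1 ∧ p + u ∈ X ∧ q = p + u :=
    fun q hq hpq => ⟨q - p, c1_adj_iff.1 hpq, by rwa [add_sub_cancel], by rw [add_sub_cancel]⟩
  have hpar : ∀ u v : Pt, |u.1| + |u.2| = 1 → |v.1| + |v.2| = 1 → cross u v = 0 →
      p + u ∈ X → p + v ∈ X → u = v := by
    intro u v hu hv huv hpu hpv
    have h : u = v ∨ u = -v := by
      rcases eq_of_abs_add_abs_eq_one hu with rfl | rfl | rfl | rfl <;>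
      rcases eq_of_abs_add_abs_eq_one hv with rfl | rfl | rfl | rfl <;> simp [cross] at huv ⊢
    refine h.resolve_right fun h => hopp v hv hpv ?_
    rwa [sub_eq_add_neg, ← h]
  by_cases h1 : ∃ q ∈ X, c1.Adj p q
  · obtain ⟨q, hq, hpq⟩ := h1
    obtain ⟨u, hu, hpu, rfl⟩ := hnb q hq hpq
    by_cases h2 : ∃ q' ∈ X, c1.Adj p q' ∧ q' ≠ p + u
    · obtain ⟨q', hq', hpq', hne⟩ := h2
      obtain ⟨v, hv, hpv, rfl⟩ := hnb q' hq' hpq'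
      have huv : cross u v ≠ 0 := fun h => hne (by rw [hpar u v hu hv h hpu hpv])
      refine not_isFreezingSet_of_move hp (hperp u v hu hv huv hpu hpv) ?_ ?_ hB
      · intro h
        rw [add_assoc, add_eq_left] at h
        rw [eq_neg_of_add_eq_zero_left h] at huv
        simp [cross, mul_comm] at huv
      · intro w' hw' hpw'
        obtain ⟨w, hw, hpw, rfl⟩ := hnb w' hw' hpw'
        right
        by_cases huw : cross u w = 0
        · rw [← hpar u w hu hw huw hpu hpw]
          exact (c1_adj_add hv).symm
        · have hvw : cross v w = 0 := by
            rcases eq_of_abs_add_abs_eq_one hu with rfl | rfl | rfl | rfl <;>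
            rcases eq_of_abs_add_abs_eq_one hv with rfl | rfl | rfl | rfl <;>
            rcases eq_of_abs_add_abs_eq_one hw with rfl | rfl | rfl | rfl <;>
            simp [cross] at huv huw ⊢
          rw [← hpar v w hv hw hvw hpv hpw, add_right_comm]
          exact (c1_adj_add hu).symm
    · push Not at h2
      exact not_isFreezingSet_of_move hp hpu hpq.ne' (fun q hq hpq => Or.inl (h2 q hq hpq)) hB
  · push Not at h1
    exact not_isFreezingSet_of_move hp hr hrp (fun q hq hpq => absurd hpq (h1 q hq)) hB

/-- The shifted index makes `S.step i` and `S.step (i + 1)` the steps into and out of `p`. The last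
point of a slanted side counts as a turn. -/
lemma exists_index_of_mem {S : ClosedCurve} {p : Pt}
    (hp : p ∈ axialEndpoints S ∪ slantedPoints S) :
    ∃ i, p = S.pt (i + 1) ∧ (S.step (i + 1) ≠ S.step i ∨ IsSlanted (S.step (i + 1))) := by
  have hend : ∀ a b, S.IsSide a b → S.step b ≠ S.step (b - 1) := fun a b hs => by
    rw [hs.2.1 (b - 1) (by have := hs.1; omega) (by omega)]
    exact hs.2.2.2
  rcases hp with ⟨a, b, hs, -, rfl | rfl⟩ | ⟨a, b, hs, hsl, i, hai, hib, rfl⟩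
  · exact ⟨a - 1, by simp, Or.inl (by simpa using hs.2.2.1.symm)⟩
  · exact ⟨b - 1, by simp, Or.inl (by simpa using hend a b hs)⟩
  · rcases hib.lt_or_eq with h | rfl
    · exact ⟨i - 1, by simp, Or.inr (by simpa [hs.2.1 i hai h] using hsl)⟩
    · exact ⟨i - 1, by simp, Or.inl (by simpa using hend a i hs)⟩

/-! ### Neighbors of a vertex or of a point of a slanted side -/

namespace ClosedCurve

variable {S : ClosedCurve} {X : Set Pt} {ε : ℤ}

lemma cross_step_nonneg_of_supports (h : ∀ i, S.Supports ε X i) {i : ℤ} {u : Pt}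
    (hu : S.pt (i + 1) + u ∈ X) :
    0 ≤ ε * cross (S.step i) u ∧ 0 ≤ ε * cross (S.step (i + 1)) u := by
  constructor
  · have := h i _ hu
    rwa [S.pt_succ, add_assoc, add_sub_cancel_left, cross_add_right, cross_self, zero_add] at this
  · have := h (i + 1) _ hu
    rwa [add_sub_cancel_left] at this

/-- A vertex, or a point of a slanted side, does not lie between two points of the disk. -/
lemma sub_notMem_of_add_mem (hsup : ∀ i, S.Supports ε X i)
    (hrev : ∀ i, S.step (i + 1) ≠ -S.step i) (hε : ε = 1 ∨ ε = -1) {i : ℤ}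
    (hi : S.step (i + 1) ≠ S.step i ∨ IsSlanted (S.step (i + 1))) {u : Pt}
    (hu : |u.1| + |u.2| = 1) (h1 : S.pt (i + 1) + u ∈ X) : S.pt (i + 1) - u ∉ X := by
  intro h2
  rw [sub_eq_add_neg] at h2
  obtain ⟨a1, a2⟩ := cross_step_nonneg_of_supports hsup h1
  obtain ⟨b1, b2⟩ := cross_step_nonneg_of_supports hsup h2
  rw [cross_neg_right] at b1 b2
  -- A linear form nonnegative at `u` and at `-u` vanishes at `u`. But an axial `u` is parallel
  -- neither to a slanted step nor to two non-parallel steps.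
  have c1 : cross (S.step i) u = 0 := by rcases hε with rfl | rfl <;> omega
  have c2 : cross (S.step (i + 1)) u = 0 := by rcases hε with rfl | rfl <;> omega
  by_cases hd : S.step (i + 1) = S.step i
  · obtain ⟨h3, h4⟩ := hi.resolve_left (not_not.2 hd)
    rcases eq_of_abs_add_abs_eq_one hu with rfl | rfl | rfl | rfl <;>
    simp [cross] at c2 <;> simp [c2] at h3 h4
  · refine cross_step_ne_zero hd (hrev i) ?_
    rcases eq_of_abs_add_abs_eq_one hu with rfl | rfl | rfl | rfl <;>
    simp [cross] at c1 c2 <;> simp [cross, c1, c2]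

/-- Two directions `d`, `e` in the closed quadrant opposite to the one bisected by `f`: one of them,
or their sum, is `-f`. -/
lemma eq_neg_or_add_eq_neg {u v d e f : Pt} (hε : ε = 1 ∨ ε = -1) (hu : |u.1| + |u.2| = 1)
    (hv : |v.1| + |v.2| = 1) (huv : cross u v ≠ 0)
    (hd : (-1 ≤ d.1 ∧ d.1 ≤ 1) ∧ (-1 ≤ d.2 ∧ d.2 ≤ 1) ∧ (d.1 ≠ 0 ∨ d.2 ≠ 0))
    (he : (-1 ≤ e.1 ∧ e.1 ≤ 1) ∧ (-1 ≤ e.2 ∧ e.2 ≤ 1) ∧ (e.1 ≠ 0 ∨ e.2 ≠ 0))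
    (hne : e ≠ -d) (hde : e ≠ d ∨ IsSlanted e)
    (hdu : 0 ≤ ε * cross d u) (hdv : 0 ≤ ε * cross d v)
    (heu : 0 ≤ ε * cross e u) (hev : 0 ≤ ε * cross e v)
    (hfu : ε * cross f u = -1) (hfv : ε * cross f v = -1) :
    d = -f ∨ e = -f ∨ d + e = -f := by
  obtain ⟨d, d'⟩ := d
  obtain ⟨e, e'⟩ := e
  obtain ⟨f, f'⟩ := f
  obtain ⟨⟨h1, h2⟩, ⟨h3, h4⟩, h5⟩ := hd
  obtain ⟨⟨h6, h7⟩, ⟨h8, h9⟩, h10⟩ := he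
  have hde' : e ≠ d ∨ e' ≠ d' ∨ (e ≠ 0 ∧ e' ≠ 0) := by
    rcases hde with h | ⟨h, h'⟩
    · simp only [ne_eq, Prod.mk.injEq] at h; tauto
    · refine Or.inr (Or.inr ⟨?_, ?_⟩) <;> rintro rfl <;> simp at h h'
  have hne' : e ≠ -d ∨ e' ≠ -d' := by
    simp only [ne_eq, Prod.mk.injEq, Prod.neg_mk] at hne; tauto
  clear hde hne
  simp only [cross] at *
  simp only [Prod.mk.injEq, Prod.neg_mk, Prod.mk_add_mk]
  rcases hε with rfl | rfl <;>
  rcases eq_of_abs_add_abs_eq_one hu with rfl | rfl | rfl | rfl <;>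
  rcases eq_of_abs_add_abs_eq_one hv with rfl | rfl | rfl | rfl <;>
  first
  | exact absurd rfl huv
  | (clear hu hv huv
     simp only [mul_zero, mul_one, one_mul, mul_neg, neg_mul, zero_sub, sub_zero, neg_neg,
       neg_inj] at *
     omega)

/-- If two perpendicular neighbors of a vertex, or of a point of a slanted side, are in the disk,
then so is the fourth corner of the unit square: otherwise the disk would be contained in a slanted
strip that leaves no room for an interior point `x`. -/
lemma add_add_mem (hX : X = S.polygon ε) (hrev : ∀ i, S.step (i + 1) ≠ -S.step i)
    (hε : ε = 1 ∨ ε = -1) {x : Pt} (hx : ∀ u : Pt, |u.1| + |u.2| = 1 → x + u ∈ X) {i : ℤ}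
    (hi : S.step (i + 1) ≠ S.step i ∨ IsSlanted (S.step (i + 1))) {u v : Pt}
    (hu : |u.1| + |u.2| = 1) (hv : |v.1| + |v.2| = 1) (huv : cross u v ≠ 0)
    (h1 : S.pt (i + 1) + u ∈ X) (h2 : S.pt (i + 1) + v ∈ X) : S.pt (i + 1) + u + v ∈ X := by
  have hsup : ∀ i, S.Supports ε X i := fun i y hy => by
    rw [hX] at hy; exact hy i
  by_contra hq
  have hq' : S.pt (i + 1) + u + v ∉ S.polygon ε := hX ▸ hq
  obtain ⟨j, hj⟩ : ∃ j, ε * cross (S.step j) (S.pt (i + 1) + u + v - S.pt j) < 0 := by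
    by_contra! hc
    exact hq' hc
  have hju := hsup j _ h1
  have hjv := hsup j _ h2
  have hxu := hsup j _ (hx u hu)
  rw [cross_sub_right, cross_add_right] at hju hjv hxu
  rw [cross_sub_right, cross_add_right, cross_add_right] at hj
  obtain ⟨a1, a2⟩ := cross_step_nonneg_of_supports hsup h1
  obtain ⟨b1, b2⟩ := cross_step_nonneg_of_supports hsup h2
  have hxm : x - u ∈ X := by
    rw [sub_eq_add_neg]
    exact hx (-u) (by simpa using hu)
  have hx1 : 0 ≤ ε * (cross (S.step i) (x - u) - cross (S.step i) (S.pt (i + 1))) := by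
    have := hsup i _ hxm
    rw [cross_sub_right] at this
    rwa [S.pt_succ i, cross_add_right, cross_self, add_zero]
  have hx2 : 0 ≤ ε * (cross (S.step (i + 1)) (x - u) - cross (S.step (i + 1)) (S.pt (i + 1))) := by
    rw [← cross_sub_right]
    exact hsup (i + 1) _ hxm
  have hbd : ∀ w : Pt, |w.1| + |w.2| = 1 → -1 ≤ ε * cross (S.step j) w := by
    intro w hw
    obtain ⟨f1, f2, -⟩ := S.step_bounds j
    rcases hε with rfl | rfl <;> rcases eq_of_abs_add_abs_eq_one hw with rfl | rfl | rfl | rfl <;>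
    simp only [cross] <;> omega
  have hbu := hbd u hu
  have hbv := hbd v hv
  -- The form of step `j` changes by at most one along a unit vector, is nonnegative at both
  -- neighbors and negative at the fourth corner. So it drops by exactly one along `u` and along
  -- `v`, and is below two at `S.pt (i + 1)`.
  have hfu : ε * cross (S.step j) u = -1 := by
    rw [mul_sub, mul_add] at hjv
    rw [mul_sub, mul_add, mul_add] at hj
    omega
  have hfv : ε * cross (S.step j) v = -1 := by
    rw [mul_sub, mul_add] at hju
    rw [mul_sub, mul_add, mul_add] at hj
    omega
  have hdir := eq_neg_or_add_eq_neg hε hu hv huv (S.step_bounds i) (S.step_bounds (i + 1)) (hrev i)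
    hi a1 b1 a2 b2 hfu hfv
  -- The reverse of step `j` is one of the two steps at the vertex or their sum, so the form of step
  -- `j` is no larger at `x - u` than at `S.pt (i + 1)`. Yet it is nonnegative at `x + u`, hence at
  -- least two at `x - u`.
  have hneg : 0 ≤ -(ε * (cross (S.step j) (x - u) - cross (S.step j) (S.pt (i + 1)))) := by
    have e : ∀ w, -(ε * (cross (S.step j) w - cross (S.step j) (S.pt (i + 1))))
        = ε * (cross (-S.step j) w - cross (-S.step j) (S.pt (i + 1))) := fun w => by
      simp only [cross, Prod.fst_neg, Prod.snd_neg]; ring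
    rw [e]
    rcases hdir with h | h | h <;> rw [← h]
    · exact hx1
    · exact hx2
    · refine (add_nonneg hx1 hx2).trans_eq ?_
      simp only [cross, Prod.fst_add, Prod.snd_add]; ring
  rw [cross_sub_right] at hneg
  linarith

end ClosedCurve

end DigitalPlane

open DigitalPlane in
theorem theorem3p6 (X : Set DigitalPlane.Pt) (S : DigitalPlane.ClosedCurve)
    (hconv : DigitalPlane.IsConvexDisk X S) (hthick : DigitalPlane.IsThick X) :
    DigitalPlane.IsMinimalFreezingSet DigitalPlane.c1 X
      (DigitalPlane.axialEndpoints S ∪ DigitalPlane.slantedPoints S) := by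
  obtain ⟨hbd, hseg, -⟩ := hconv
  refine ⟨isFreezingSet_axialEndpoints_union_slantedPoints hbd, fun B hB => ?_⟩
  obtain ⟨F, hfin, hX, hF, huniq⟩ := hbd.exists_interior
  have hSX : S.carrier ⊆ X := hX ▸ Set.subset_union_left
  obtain ⟨x, hx⟩ := hF.1
  have hxX : x ∈ X := hX ▸ Or.inr hx
  have hnb : ∀ u : Pt, |u.1| + |u.2| = 1 → x + u ∈ X := fun u hu =>
    interior_neighbor_mem hX hF hx (c1_adj_add hu)
  have hrev : ∀ i, S.step (i + 1) ≠ -S.step i := by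
    obtain ⟨m, hm, hmS, -⟩ := exists_ray hfin hX hF hx (u := (1, 0)) (by simp)
    obtain ⟨n, hn, hnS, -⟩ := exists_ray hfin hX hF hx (u := (-1, 0)) (by simp)
    exact ClosedCurve.step_succ_ne_neg hmS hnS (by simp; omega)
  obtain ⟨ε, hε, hsup⟩ := ClosedCurve.exists_supports hSX
    (ClosedCurve.supports_or_supports_neg hSX
      (hull_interior_nonempty hxX (hnb _ (by simp)) (hnb _ (by simp))) hseg) hrev
  obtain ⟨p, hpA, hpB⟩ := Set.exists_of_ssubset hB
  have hpS := axialEndpoints_union_slantedPoints_subset S hpA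
  obtain ⟨i, rfl, hi⟩ := exists_index_of_mem hpA
  exact not_isFreezingSet_of_neighbors (hSX hpS) hxX
    (fun h => hF.2.1.1 hx (h ▸ hpS))
    (fun u hu h => ClosedCurve.sub_notMem_of_add_mem hsup hrev hε hi hu h)
    (fun u v hu hv huv => ClosedCurve.add_add_mem (ClosedCurve.eq_polygon hX huniq hsup hrev hε)
      hrev hε hnb hi hu hv huv) hpB
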